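/- Let $L/K$ be a finite Galois extension of fields with Galois group $\Gamma=\mathrm{Gal}(L/K)$. A Hopf-Galois structure on $L/K$ consists of a $K$-Hopf algebra $H$, with comultiplication $\Delta(h)=\sum_{(h)}h_{(1)}\otimes h_{(2)}$ and counit $\epsilon$, together with a $K$-linear action of $H$ on $L$ making $L$ an $H$-module such that $h\cdot(xy)=\sum_{(h)}(h_{(1)}\cdot x)(h_{(2)}\cdot y)$ and $h\cdot k=\epsilon(h)k$ for all $h\in H$, $x,y\in L$, $k\in K$, and such that the $K$-linear map $\theta\colon L\otimes_K L\to \mathrm{Hom}_K(H,L)$, $\theta(x\otimes y)(h)=x(h\cdot y)$, is bijective. It is said to be of type $G$, for a group $G$, if $L\otimes_K H\cong L[G]$ as $L$-Hopf algebras. Suppose that $L/K$ admits a Hopf-Galois structure of type $G$. If $G$ is nilpotent, then $\Gamma$ is soluble. Thus, if a finite Galois extension of fields admits a Hopf-Galois structure of nilpotent type, then the extension has soluble Galois group. -/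

import Mathlib

open scoped TensorProduct

noncomputable section

/-- For a `K`-algebra `H` acting `K`-linearly on `L`, the canonical map
`θ : L ⊗[K] L → Hom_K(H, L)`, `θ (x ⊗ y) h = x * (h · y)`. -/
def hopfGaloisMap {K L H : Type*} [Field K] [Field L] [Algebra K L] [Ring H] [Algebra K H]
    (act : H →ₐ[K] Module.End K L) : L ⊗[K] L →ₗ[K] (H →ₗ[K] L) :=
  TensorProduct.lift <|
    LinearMap.mk₂ K (fun x y => LinearMap.mulLeft K x ∘ₗ act.toLinearMap.flip y)
      (fun x x' y => by ext h; simp [add_mul])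
      (fun c x y => by ext h; simp)
      (fun x y y' => by ext h; simp [mul_add])
      (fun c x y => by ext h; simp)

/-- A Hopf-Galois structure on the field extension `L/K` with acting `K`-Hopf algebra `H`:
an action of `H` making `L` an `H`-module algebra, for which the canonical map
`L ⊗[K] L → Hom_K(H, L)` is bijective. -/
structure HopfGaloisStructure (K L H : Type*) [Field K] [Field L] [Algebra K L]
    [Ring H] [HopfAlgebra K H] where
  /-- The (unital, associative, `K`-linear) action `h · x = act h x`. -/
  act : H →ₐ[K] Module.End K L
  /-- `h · (x * y) = ∑ (h₁ · x) * (h₂ · y)`, where `Δ h = ∑ h₁ ⊗ h₂`. -/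
  act_mul : ∀ (h : H) (x y : L),
    act h (x * y) = LinearMap.mul' K L
      (TensorProduct.map (act.toLinearMap.flip x) (act.toLinearMap.flip y)
        (Coalgebra.comul (R := K) h))
  /-- `h · k = ε(h) k` for `k ∈ K`. -/
  act_algebraMap : ∀ (h : H) (k : K),
    act h (algebraMap K L k) = Coalgebra.counit (R := K) h • algebraMap K L k
  bijective : Function.Bijective (hopfGaloisMap act)

/-- A Hopf-Galois structure on `L/K` with acting Hopf algebra `H` has type `G` if `H` becomes,
after base change to `L`, the group algebra of `G` as an `L`-Hopf algebra: `L ⊗[K] H ≅ L[G]`.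
(An isomorphism of bialgebras between Hopf algebras commutes with the antipodes.) For a finite
Galois extension this says that `H` is the fixed Hopf algebra `L[N]^Gal(L/K)` of a regular
permutation group `N ≅ G`. -/
def HopfGaloisStructure.HasType {K L H : Type*} [Field K] [Field L] [Algebra K L]
    [Ring H] [HopfAlgebra K H] (_S : HopfGaloisStructure K L H) (G : Type*) [Group G] : Prop :=
  Nonempty ((L ⊗[K] H) ≃ₐc[L] MonoidAlgebra L G)

end

/-! Over `L` the Hopf algebra becomes `L[G]`, so each `g : G` is a group-like element of `L ⊗ H`,
and such an element acts on `L` as a `K`-automorphism σ_g. Bijectivity of θ makes g ↦ σ_g injective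
and forces |G| = [L : K], so G → Γ is a bijection (`galOf_bijective`). It need not be a
homomorphism: σ_g σ_h = σ_{gh'}, where h' is the image of h under the ring automorphism σ_g ⊗ id of
`L ⊗ H` (`exists_galOf_mul`). But h' has the same order as h, so a subgroup of `G` described by
element orders alone is carried onto a subgroup of Γ.

In a nilpotent group the elements of order prime to p form such a subgroup, a p-complement. Hence Γ
has a p-complement for every prime p, and P. Hall's criterion makes it soluble.

Hall's criterion rests on Burnside's theorem when at most two primes divide the order, and on
Wielandt's theorem for three soluble subgroups of coprime indices otherwise. Burnside's theorem is
proved by characters. -/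

namespace Complex

/-! ### Averages of roots of unity. -/

theorem eq_of_norm_sum_eq_card {s : Multiset ℂ} (hs : ∀ z ∈ s, ‖z‖ ≤ 1) {a : ℂ} (ha : ‖a‖ = 1)
    (hsum : s.sum = s.card * a) {z : ℂ} (hz : z ∈ s) : z = a := by
  have hle (w : ℂ) (hw : w ∈ s) : (starRingEnd ℂ a * w).re ≤ 1 :=
    (re_le_norm _).trans (by rw [norm_mul, norm_conj, ha, one_mul]; exact hs w hw)
  have haa : starRingEnd ℂ a * a = 1 := by rw [conj_mul', ha]; simp
  -- Equality case of the triangle inequality: after rotating `a` to 1, each real part is at most 1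
  -- and their sum is the number of terms.
  have hre : (starRingEnd ℂ a * z).re = 1 := by
    refine le_antisymm (hle z hz) (not_lt.1 fun hlt => ?_)
    have h1 := Multiset.sum_lt_sum (f := fun w => (starRingEnd ℂ a * w).re) (g := fun _ => (1 : ℝ))
      hle ⟨z, hz, hlt⟩
    have h2 : (s.map fun w => (starRingEnd ℂ a * w).re).sum = s.card := by
      have := congrArg (fun w => (starRingEnd ℂ a * w).re) hsum
      rw [mul_left_comm, haa, mul_one, natCast_re] at this
      rw [← this]
      conv_rhs => rw [← Multiset.map_id' s, ← Multiset.sum_map_mul_left]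
      refine Eq.trans ?_ (map_multiset_sum reAddGroupHom _).symm
      rw [Multiset.map_map]
      rfl
    rw [h2] at h1
    simp at h1
  have hone : starRingEnd ℂ a * z = 1 := by
    have hn : normSq (starRingEnd ℂ a * z) ≤ 1 := by
      rw [normSq_eq_norm_sq, norm_mul, norm_conj, ha, one_mul]
      exact pow_le_one₀ (norm_nonneg z) (hs z hz)
    rw [normSq_apply, hre] at hn
    refine Complex.ext hre (mul_self_eq_zero.1 (le_antisymm ?_ (mul_self_nonneg _)))
    linarith
  rw [← one_mul z, ← haa, mul_comm _ a, mul_assoc, hone, mul_one]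

/-- If the average of a family of roots of unity is a nonzero algebraic integer, then the family
is constant. -/
theorem eq_of_isIntegral_average {n : ℕ} (hn : n ≠ 0) {s : Multiset ℂ} (hs : ∀ z ∈ s, z ^ n = 1)
    {a : ℂ} (hsum : s.sum = s.card * a) (ha : IsIntegral ℤ a) (ha0 : a ≠ 0)
    {z : ℂ} (hz : z ∈ s) : z = a := by
  have hnorm {w : ℂ} (hw : w ^ n = 1) : ‖w‖ = 1 := norm_eq_one_of_pow_eq_one hw hn
  refine eq_of_norm_sum_eq_card (fun w hw => (hnorm (hs w hw)).le) ?_ hsum hz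
  have hcard : (s.card : ℂ) ≠ 0 := by
    simpa using fun h : s = 0 => by simp [h] at hz
  let F := IntermediateField.adjoin ℚ {w : ℂ | w ∈ s}
  have hfin : FiniteDimensional ℚ F := by
    have : Finite {w : ℂ | w ∈ s} := (Multiset.finite_toSet s)
    refine IntermediateField.finiteDimensional_adjoin fun w hw => ?_
    exact .of_pow (Nat.pos_of_ne_zero hn) (by rw [hs w hw]; exact isIntegral_one)
  obtain ⟨t, ht⟩ : ∃ t : Multiset F, t.map (algebraMap F ℂ) = s := by
    have hmem : ∀ w ∈ s, w ∈ F := fun w hw => IntermediateField.subset_adjoin ℚ _ hw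
    exact ⟨s.pmap Subtype.mk hmem, by
      rw [Multiset.map_pmap]; exact (Multiset.pmap_eq_map _ _ s hmem).trans (Multiset.map_id' s)⟩
  rw [← ht, Multiset.card_map] at hsum hcard
  rw [← ht] at hs
  obtain ⟨b, rfl⟩ : ∃ b : F, algebraMap F ℂ b = a :=
    ⟨t.sum / t.card, by
      rw [map_div₀, map_multiset_sum, hsum, map_natCast, mul_div_cancel_left₀ _ hcard]⟩
  have hb : IsIntegral ℤ b := (isIntegral_algebraMap_iff (algebraMap F ℂ).injective).1 ha
  have hb0 : b ≠ 0 := fun h => ha0 (by rw [h, map_zero])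
  have htsum : t.sum = t.card * b := (algebraMap F ℂ).injective (by
    rw [map_multiset_sum, hsum, map_mul, map_natCast])
  -- Every conjugate of `b` is again an average of roots of unity.
  have hσ (σ : F →ₐ[ℚ] ℂ) : ‖σ b‖ ≤ 1 := by
    have h1 : (t.map σ).sum = t.card * σ b := by
      rw [← map_multiset_sum, htsum, map_mul, map_natCast]
    have h2 : ‖(t.map σ).sum‖ ≤ t.card := by
      refine (norm_multiset_sum_le _).trans ?_
      rw [Multiset.map_map, Multiset.map_congr rfl (g := fun _ => (1 : ℝ)) fun w hw => ?_]
      · simp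
      · refine hnorm ?_
        have : w ^ n = 1 := (algebraMap F ℂ).injective (by
          rw [map_pow, map_one]; exact hs _ (Multiset.mem_map_of_mem _ hw))
        rw [← map_pow, this, map_one]
    rw [h1, norm_mul, norm_natCast] at h2
    have : (0 : ℝ) < t.card := by
      rw [Nat.cast_pos, Nat.pos_iff_ne_zero]; exact_mod_cast hcard
    exact le_of_mul_le_mul_left (by linarith) this
  -- The norm of `b` is a nonzero rational integer. As no conjugate exceeds 1 in absolute value, `b`
  -- itself has absolute value 1.
  have hprod : 1 ≤ ∏ σ : F →ₐ[ℚ] ℂ, ‖σ b‖ := by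
    obtain ⟨m, hm⟩ := IsIntegrallyClosed.isIntegral_iff.1 (Algebra.isIntegral_norm ℚ hb)
    have hm0 : m ≠ 0 := by
      rintro rfl
      exact Algebra.norm_ne_zero_iff.2 hb0 (by rw [← hm, map_zero])
    rw [← norm_prod, ← Algebra.norm_eq_prod_embeddings, ← hm]
    simpa using (by exact_mod_cast Int.one_le_abs hm0 : (1 : ℝ) ≤ |(m : ℝ)|)
  refine le_antisymm (hσ F.val) (hprod.trans ?_)
  classical
  refine (Finset.mul_prod_erase Finset.univ (fun σ : F →ₐ[ℚ] ℂ => ‖σ b‖)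
    (Finset.mem_univ F.val)).ge.trans ?_
  exact mul_le_of_le_one_right (norm_nonneg _)
    (Finset.prod_le_one (fun _ _ => norm_nonneg _) fun σ _ => hσ σ)

end Complex

/-! ### Complex matrices of finite order. -/

namespace Matrix

variable {ι : Type*} [Fintype ι] [DecidableEq ι]

theorem pow_eq_one_of_mem_roots_charpoly {A : Matrix ι ι ℂ} {n : ℕ} (hA : A ^ n = 1) {z : ℂ}
    (hz : z ∈ A.charpoly.roots) : z ^ n = 1 := by
  have h1 : z ∈ spectrum ℂ A :=
    mem_spectrum_iff_isRoot_charpoly.2 (Polynomial.isRoot_of_mem_roots hz)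
  have h2 := spectrum.pow_mem_pow A n h1
  rcases isEmpty_or_nonempty ι with h | h
  · simp at hz
  · rw [hA, spectrum.one_eq] at h2
    exact h2

theorem isIntegral_trace_of_pow_eq_one {A : Matrix ι ι ℂ} {n : ℕ} (hn : n ≠ 0) (hA : A ^ n = 1) :
    IsIntegral ℤ A.trace := by
  rw [trace_eq_sum_roots_charpoly]
  refine IsIntegral.multiset_sum fun z hz => .of_pow (Nat.pos_of_ne_zero hn) ?_
  rw [pow_eq_one_of_mem_roots_charpoly hA hz]
  exact isIntegral_one

/-- The eigenvalues are roots of unity with average `a`, so all equal `a`. Thus `A` is killed by a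
power of X - a and by X ^ n - 1, of which `a` is a simple root; hence by their gcd X - a. -/
theorem eq_algebraMap_of_pow_eq_one {A : Matrix ι ι ℂ} {n : ℕ} (hn : n ≠ 0) (hA : A ^ n = 1)
    {a : ℂ} (htr : A.trace = Fintype.card ι * a) (ha : IsIntegral ℤ a) (ha0 : a ≠ 0) :
    A = algebraMap ℂ _ a := by
  have hcard : A.charpoly.roots.card = Fintype.card ι := by
    rw [← (IsAlgClosed.splits A.charpoly).natDegree_eq_card_roots, charpoly_natDegree_eq_dim]
  have hroots : A.charpoly.roots = Multiset.replicate (Fintype.card ι) a := by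
    refine Multiset.eq_replicate.2 ⟨hcard, fun z hz => ?_⟩
    refine Complex.eq_of_isIntegral_average hn (fun w hw => pow_eq_one_of_mem_roots_charpoly hA hw)
      ?_ ha ha0 hz
    rw [← trace_eq_sum_roots_charpoly, htr, hcard]
  rcases isEmpty_or_nonempty ι with h | h
  · exact Subsingleton.elim _ _
  have han : a ^ n = 1 := pow_eq_one_of_mem_roots_charpoly hA (by
    rw [hroots]; exact Multiset.mem_replicate.2 ⟨Fintype.card_ne_zero, rfl⟩)
  open Polynomial in
  have hchar : A.charpoly = (X - C a) ^ Fintype.card ι := by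
    have := (IsAlgClosed.splits A.charpoly).eq_prod_roots_of_monic A.charpoly_monic
    rw [this, hroots]; simp
  open Polynomial in
  obtain ⟨q, hq⟩ : (X - C a) ∣ (X ^ n - 1 : ℂ[X]) := dvd_iff_isRoot.2 (by simp [han])
  open Polynomial in
  have hqa : q.eval a ≠ 0 := by
    have := congrArg (fun f => (derivative f).eval a) hq
    simp [derivative_X_pow] at this
    rw [← this]
    exact mul_ne_zero (Nat.cast_ne_zero.2 hn) (pow_ne_zero _ ha0)
  open Polynomial in
  have hcop : IsCoprime q ((X - C a) ^ Fintype.card ι) :=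
    (((irreducible_X_sub_C a).coprime_iff_not_dvd.2 fun h =>
      hqa (dvd_iff_isRoot.1 h)).symm).pow_right
  obtain ⟨u, v, huv⟩ := hcop
  open Polynomial in
  have := congrArg (fun f => aeval A (f * (X - C a))) huv
  open Polynomial in
  have h1 : aeval A ((X - C a) ^ Fintype.card ι) = 0 := by
    rw [← hchar]; exact aeval_self_charpoly A
  open Polynomial in
  have h2 : aeval A (q * (X - C a)) = 0 := by
    rw [mul_comm, ← hq]; simp [hA]
  simp only [add_mul, map_add, mul_assoc, one_mul] at this
  rw [map_mul, h2, map_mul, map_mul, h1] at this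
  simpa [sub_eq_zero] using this.symm

end Matrix

/-! ### Characters of finite groups. -/

/-- In block `i`, left multiplication acts as `A i` on each of the `d i` columns separately. -/
theorem LinearMap.trace_mulLeft_pi_matrix {k : Type*} [Field k] {n : ℕ} (d : Fin n → ℕ)
    (A : ∀ i, Matrix (Fin (d i)) (Fin (d i)) k) :
    LinearMap.trace k _ (LinearMap.mulLeft k A) = ∑ i, (d i : k) * (A i).trace := by
  classical
  rw [LinearMap.trace_eq_matrix_trace k
    (Pi.basis fun i => Matrix.stdBasis k (Fin (d i)) (Fin (d i))), Matrix.trace,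
    Fintype.sum_sigma]
  refine Finset.sum_congr rfl fun i _ => ?_
  rw [Fintype.sum_prod_type, Matrix.trace, Finset.mul_sum]
  refine Finset.sum_congr rfl fun r _ => ?_
  have (c : Fin (d i)) : (LinearMap.toMatrix
      (Pi.basis fun i => Matrix.stdBasis k (Fin (d i)) (Fin (d i)))
      (Pi.basis fun i => Matrix.stdBasis k (Fin (d i)) (Fin (d i)))
      (LinearMap.mulLeft k A)).diag ⟨i, r, c⟩ = A i r r := by
    rw [Matrix.diag_apply, LinearMap.toMatrix_apply, Pi.basis_apply, Pi.basis_repr,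
      LinearMap.mulLeft_apply, Pi.mul_apply, Pi.single_eq_same, Matrix.stdBasis_eq_single]
    change (A i * (Matrix.single r c 1 : Matrix (Fin (d i)) (Fin (d i)) k)) r c = A i r r
    simp
  rw [Finset.sum_congr rfl fun c _ => this c]
  simp

theorem MonoidAlgebra.trace_mulLeft_single {k G : Type*} [Field k] [Group G] [Fintype G]
    [DecidableEq G] (g : G) :
    LinearMap.trace k _ (LinearMap.mulLeft k (MonoidAlgebra.single g (1 : k))) =
      if g = 1 then (Fintype.card G : k) else 0 := by
  let b : Module.Basis G k (MonoidAlgebra k G) := .ofRepr (MonoidAlgebra.coeffLinearEquiv k)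
  have hb (x : G) : b x = MonoidAlgebra.single x 1 := rfl
  rw [LinearMap.trace_eq_matrix_trace k b, Matrix.trace]
  have (x : G) : (LinearMap.toMatrix b b (LinearMap.mulLeft k (single g 1))).diag x =
      if g = 1 then 1 else 0 := by
    rw [Matrix.diag_apply, LinearMap.toMatrix_apply, hb, LinearMap.mulLeft_apply, single_mul_single,
      mul_one, ← hb, Module.Basis.repr_self, Finsupp.single_apply]
    simp
  rw [Finset.sum_congr rfl fun x _ => this x]
  simp

/-- The irreducible complex matrix representations of a finite group, and the decomposition of
the regular character in terms of them. Irreducibility is recorded as Schur's lemma. -/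
theorem MonoidHom.exists_matrix_decomposition (G : Type*) [Group G] [Fintype G] [DecidableEq G] :
    ∃ (n : ℕ) (d : Fin n → ℕ) (ρ : ∀ i, G →* Matrix (Fin (d i)) (Fin (d i)) ℂ),
      (∀ i, d i ≠ 0) ∧
      (∀ i A, (∀ g, Commute A (ρ i g)) → ∃ c : ℂ, A = algebraMap ℂ _ c) ∧
      (∀ g, ∑ i, (d i : ℂ) * (ρ i g).trace = if g = 1 then (Fintype.card G : ℂ) else 0) := by
  have : NeZero (Nat.card G : ℂ) := ⟨Nat.cast_ne_zero.2 Nat.card_pos.ne'⟩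
  obtain ⟨n, d, hd, ⟨e⟩⟩ :=
    IsSemisimpleRing.exists_algEquiv_pi_matrix_of_isAlgClosed ℂ (MonoidAlgebra ℂ G)
  let f (i : Fin n) : MonoidAlgebra ℂ G →ₐ[ℂ] Matrix (Fin (d i)) (Fin (d i)) ℂ :=
    (Pi.evalAlgHom ℂ (fun i => Matrix (Fin (d i)) (Fin (d i)) ℂ) i).comp e.toAlgHom
  have hf (i) : Function.Surjective (f i) := (Function.surjective_eval i).comp e.surjective
  refine ⟨n, d, fun i => (f i : MonoidAlgebra ℂ G →* _).comp (MonoidAlgebra.of ℂ G),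
    fun i => (hd i).out, fun i A hA => ?_, fun g => ?_⟩
  · have hcomm (B) : Commute A B := by
      obtain ⟨r, rfl⟩ := hf i B
      induction r using MonoidAlgebra.induction_on with
      | of g => exact hA g
      | add x y hx hy => rw [map_add]; exact hx.add_right hy
      | smul c x hx => rw [map_smul]; exact hx.smul_right c
    obtain ⟨c, rfl⟩ := Matrix.mem_range_scalar_iff_commute_single.2
      fun i j _ => (hcomm (Matrix.single i j 1)).symm
    exact ⟨c, rfl⟩
  -- The trace of left multiplication by `g` is computed twice: on the basis `G` and on the matrix
  -- blocks.
  · rw [← MonoidAlgebra.trace_mulLeft_single, ← LinearMap.trace_conj' _ e.toLinearEquiv]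
    refine (LinearMap.trace_mulLeft_pi_matrix d
      fun i => f i (MonoidAlgebra.single g 1)).symm.trans ?_
    congr 1
    refine LinearMap.ext fun x => ?_
    rw [LinearEquiv.conj_apply_apply]
    change _ = e (MonoidAlgebra.single g 1 * e.symm x)
    rw [map_mul, e.apply_symm_apply]
    rfl

/-- If the size of the conjugacy class of `g` is prime to the degree of an irreducible
representation, then `g` acts by a scalar or has trace zero. -/
theorem MonoidHom.trace_eq_zero_or_eq_algebraMap {G : Type*} [Group G] [Fintype G] {d : ℕ}
    (hd : d ≠ 0) (ρ : G →* Matrix (Fin d) (Fin d) ℂ)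
    (hρ : ∀ A, (∀ g, Commute A (ρ g)) → ∃ c : ℂ, A = algebraMap ℂ _ c) (g : G)
    (hg : (Subgroup.centralizer {g}).index.Coprime d) :
    (ρ g).trace = 0 ∨ ∃ c, ρ g = algebraMap ℂ _ c := by
  classical
  let C : Finset G := Finset.univ.filter (IsConj g)
  have hC : C.card = (Subgroup.centralizer {g}).index := by
    have hset : MulAction.orbit (ConjAct G) g = (C : Set G) := by
      ext x
      rw [ConjAct.mem_orbit_conjAct, isConj_comm]
      simp [C]
    rw [← Set.ncard_coe_finset, ← hset, ← MulAction.index_stabilizer]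
    refine Nat.eq_of_mul_eq_mul_right
      (Nat.card_pos (α := MulAction.stabilizer (ConjAct G) g)) ?_
    rw [Subgroup.index_mul_card, ← Subgroup.nat_card_centralizer_nat_card_stabilizer,
      Subgroup.index_mul_card]
    rfl
  have hpow : ρ g ^ Fintype.card G = 1 := by rw [← map_pow, pow_card_eq_one, map_one]
  -- The class sum is central, hence acts by a scalar `c`; being integral over ℤ in ℤ[G], it makes
  -- `c` an algebraic integer.
  obtain ⟨c, hc⟩ := hρ (∑ x ∈ C, ρ x) fun h => by
    rw [commute_iff_eq, Finset.sum_mul, Finset.mul_sum]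
    refine Finset.sum_equiv (MulAut.conj h⁻¹).toEquiv (fun x => ?_) fun x _ => ?_
    · simp only [C, Finset.mem_filter, Finset.mem_univ, true_and]
      have : IsConj x (MulAut.conj h⁻¹ x) := isConj_iff.2 ⟨h⁻¹, rfl⟩
      exact ⟨fun hx => hx.trans this, fun hx => hx.trans this.symm⟩
    · rw [← map_mul, ← map_mul]
      simp [mul_assoc]
  have hint : IsIntegral ℤ c := by
    rw [← isIntegral_algebraMap_iff (B := Matrix (Fin d) (Fin d) ℂ) ?_, ← hc]
    · have : IsIntegral ℤ (∑ x ∈ C, MonoidAlgebra.of ℤ G x) := .of_finite ℤ _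
      simpa using this.map (MonoidAlgebra.lift ℤ _ G ρ)
    · have : Nonempty (Fin d) := ⟨⟨0, Nat.pos_of_ne_zero hd⟩⟩
      exact FaithfulSMul.algebraMap_injective ℂ _
  have htr : (d : ℂ) * c = C.card * (ρ g).trace := by
    have := congrArg Matrix.trace hc
    rw [Matrix.trace_sum, Finset.sum_congr rfl (g := fun _ => (ρ g).trace) fun x hx => ?_] at this
    · simpa [Matrix.algebraMap_eq_diagonal, eq_comm, mul_comm] using this
    · obtain ⟨h, rfl⟩ := isConj_iff.1 (Finset.mem_filter.1 hx).2
      rw [map_mul, Matrix.trace_mul_comm, ← map_mul, inv_mul_cancel_left]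
  have hd' : (d : ℂ) ≠ 0 := Nat.cast_ne_zero.2 hd
  -- From u|C| + vd = 1 and c = |C| tr / d, the normalised trace tr / d equals u c + v tr, an
  -- algebraic integer.
  obtain ⟨u, v, huv⟩ := Int.isCoprime_iff_gcd_eq_one.2 (show Int.gcd C.card d = 1 by rwa [hC])
  have hT := Matrix.isIntegral_trace_of_pow_eq_one Fintype.card_ne_zero hpow
  have key : (ρ g).trace = d * (u * c + v * (ρ g).trace) := by
    have : (u * C.card + v * d : ℂ) = 1 := by exact_mod_cast huv
    linear_combination (-u : ℂ) * htr - (ρ g).trace * this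
  refine or_iff_not_imp_left.2 fun h0 => ⟨u * c + v * (ρ g).trace, ?_⟩
  refine Matrix.eq_algebraMap_of_pow_eq_one Fintype.card_ne_zero hpow (by simpa using key) ?_ ?_
  · simpa using ((isIntegral_algebraMap (x := u)).mul hint).add
      ((isIntegral_algebraMap (x := v)).mul hT)
  · intro h
    rw [h, mul_zero] at key
    exact h0 key

/-- Burnside: in a finite simple group, an element whose conjugacy class has prime power order
is central. -/
theorem IsSimpleGroup.mem_center_of_index_centralizer_eq_pow {G : Type*} [Group G] [Finite G]
    [IsSimpleGroup G] {p k : ℕ} (hp : p.Prime) {g : G}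
    (hg : (Subgroup.centralizer {g}).index = p ^ k) : g ∈ Subgroup.center G := by
  classical
  have := Fintype.ofFinite G
  by_contra hcen
  have hg1 : g ≠ 1 := fun h => hcen (h ▸ Subgroup.one_mem _)
  obtain ⟨n, d, ρ, hd, hirr, hreg⟩ := MonoidHom.exists_matrix_decomposition G
  let T : Finset (Fin n) := Finset.univ.filter fun i => ρ i = 1
  have hdim {i} (hi : i ∈ T) : d i = 1 := by
    have hi1 : ρ i = 1 := (Finset.mem_filter.1 hi).2
    by_contra hne
    have h0 : 0 < d i := Nat.pos_of_ne_zero (hd i)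
    obtain ⟨c, hc⟩ := hirr i (Matrix.single ⟨0, h0⟩ ⟨1, by omega⟩ 1) fun x => by
      rw [hi1]; exact Commute.one_right _
    have := congrFun (congrFun hc ⟨0, h0⟩) ⟨1, by omega⟩
    rw [Matrix.algebraMap_matrix_apply] at this
    simp at this
  have htriv {i} (hi : i ∈ T) (x : G) : (d i : ℂ) * (ρ i x).trace = 1 := by
    rw [(Finset.mem_filter.1 hi).2, MonoidHom.one_apply, Matrix.trace_one, Fintype.card_fin,
      hdim hi]
    simp
  have hsum {i} (hi : i ∉ T) : ∑ x, (ρ i x).trace = 0 := by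
    have hinv (y : G) : ρ i y * ∑ x, ρ i x = ∑ x, ρ i x := by
      rw [Finset.mul_sum]
      exact Fintype.sum_equiv (Equiv.mulLeft y) _ _ fun x => (map_mul _ _ _).symm
    have hinv' (y : G) : (∑ x, ρ i x) * ρ i y = ∑ x, ρ i x := by
      rw [Finset.sum_mul]
      exact Fintype.sum_equiv (Equiv.mulRight y) _ _ fun x => (map_mul _ _ _).symm
    obtain ⟨c, hc⟩ := hirr i (∑ x, ρ i x) fun y => (hinv' y).trans (hinv y).symm
    rw [← Matrix.trace_sum]
    suffices c = 0 by rw [hc, this, map_zero, Matrix.trace_zero]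
    by_contra hc0
    refine hi (Finset.mem_filter.2 ⟨Finset.mem_univ i, MonoidHom.ext fun y => ?_⟩)
    have h1 := hinv y
    rw [hc, ← Algebra.commutes, ← Algebra.smul_def, Algebra.algebraMap_eq_smul_one] at h1
    exact smul_right_injective _ hc0 h1
  -- Summing the regular character over the group shows that the trivial representation occurs
  -- exactly once.
  have hT : (T.card : ℂ) = 1 := by
    have h1 : ∑ x : G, ∑ i, (d i : ℂ) * (ρ i x).trace = Fintype.card G := by
      simp [hreg]
    rw [Finset.sum_comm, ← Finset.sum_subset T.subset_univ fun i _ hi => by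
      rw [← Finset.mul_sum, hsum hi, mul_zero], Finset.sum_congr rfl fun i hi =>
        Finset.sum_congr rfl fun x _ => htriv hi x] at h1
    have hG : (Fintype.card G : ℂ) ≠ 0 := Nat.cast_ne_zero.2 Fintype.card_ne_zero
    simpa [hG] using h1
  have hnontriv {i} (hi : i ∉ T) : ∃ a : ℂ, IsIntegral ℤ a ∧ (d i : ℂ) * (ρ i g).trace = p * a := by
    have hpow : ρ i g ^ Fintype.card G = 1 := by rw [← map_pow, pow_card_eq_one, map_one]
    have hint := Matrix.isIntegral_trace_of_pow_eq_one Fintype.card_ne_zero hpow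
    by_cases hpd : p ∣ d i
    · obtain ⟨m, hm⟩ := hpd
      refine ⟨m * (ρ i g).trace, (isIntegral_natCast m).mul hint, ?_⟩
      rw [← mul_assoc, ← Nat.cast_mul, ← hm]
    · refine ⟨0, isIntegral_zero, ?_⟩
      rcases MonoidHom.trace_eq_zero_or_eq_algebraMap (hd i) (ρ i) (hirr i) g
        (hg ▸ Nat.Coprime.pow_left k (hp.coprime_iff_not_dvd.2 hpd)) with h0 | ⟨c, hc⟩
      · rw [h0]; simp
      · exfalso
        -- By simplicity a nontrivial `ρ i` is faithful, so a scalar image would make `g` central.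
        have hker : (ρ i).ker = ⊥ := (Subgroup.Normal.eq_bot_or_eq_top inferInstance).resolve_right
          fun h => hi (Finset.mem_filter.2 ⟨Finset.mem_univ i, (MonoidHom.ker_eq_top_iff).1 h⟩)
        refine hcen (Subgroup.mem_center_iff.2 fun x => (MonoidHom.ker_eq_bot_iff _).1 hker ?_)
        rw [map_mul, map_mul, hc, Algebra.commutes]
  choose! a ha hap using fun i (hi : i ∉ T) => hnontriv hi
  -- The regular character vanishes at `g`, which reads 1 + p b = 0 with `b` an algebraic integer.
  have h0 := hreg g
  rw [if_neg hg1, ← Finset.sum_filter_add_sum_filter_not _ (· ∈ T),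
    Finset.sum_congr rfl fun i hi => htriv (Finset.mem_filter.1 hi).2 g,
    Finset.sum_congr rfl fun i hi => hap i (Finset.mem_filter.1 hi).2, ← Finset.mul_sum] at h0
  simp only [Finset.filter_univ_mem, Finset.sum_const, nsmul_eq_mul, mul_one, hT] at h0
  set b := ∑ i with i ∉ T, a i
  have hb : IsIntegral ℤ b := IsIntegral.sum _ fun i hi => ha i (Finset.mem_filter.1 hi).2
  have hp0 : (p : ℂ) ≠ 0 := Nat.cast_ne_zero.2 hp.ne_zero
  have hbq : b = algebraMap ℚ ℂ (-1 / p) := by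
    simp only [map_div₀, map_neg, map_one, map_natCast]
    field_simp
    linear_combination h0
  rw [hbq, isIntegral_algebraMap_iff (algebraMap ℚ ℂ).injective] at hb
  obtain ⟨m, hm⟩ := IsIntegrallyClosed.isIntegral_iff.1 hb
  have hm' : (p : ℤ) * m = -1 := by
    have hp0 : (p : ℚ) ≠ 0 := Nat.cast_ne_zero.2 hp.ne_zero
    have : (p : ℚ) * m = -1 := by
      rw [show (m : ℚ) = -1 / p from hm]; field_simp
    exact_mod_cast this
  have : (p : ℤ) ∣ 1 := ⟨-m, by rw [mul_neg, hm', neg_neg]⟩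
  exact hp.one_lt.ne' (Nat.dvd_one.1 (by exact_mod_cast this))

/-! ### Burnside's theorem. -/

/-- Burnside's `p ^ a * q ^ b` theorem. -/
theorem Group.isSolvable_of_natCard_eq_mul {G : Type*} [Group G] [Finite G] {p q a b : ℕ}
    (hp : p.Prime) (hq : q.Prime) (h : Nat.card G = p ^ a * q ^ b) : Group.IsSolvable G := by
  induction hn : Nat.card G using Nat.strong_induction_on generalizing G a b with
  | _ n ih =>
  subst hn
  rcases subsingleton_or_nontrivial G with hG | hG
  · infer_instance
  by_cases hs : ∃ N : Subgroup G, N.Normal ∧ N ≠ ⊥ ∧ N ≠ ⊤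
  · obtain ⟨N, hN, hN0, hN1⟩ := hs
    have hdvd {m : ℕ} (hm : m ∣ Nat.card G) : ∃ a' b', m = p ^ a' * q ^ b' := by
      obtain ⟨x, y, hx, hy, rfl⟩ := exists_dvd_and_dvd_of_dvd_mul (h ▸ hm)
      obtain ⟨a', -, rfl⟩ := (Nat.dvd_prime_pow hp).1 hx
      obtain ⟨b', -, rfl⟩ := (Nat.dvd_prime_pow hq).1 hy
      exact ⟨a', b', rfl⟩
    obtain ⟨a₁, b₁, h₁⟩ := hdvd N.card_subgroup_dvd_card
    obtain ⟨a₂, b₂, h₂⟩ := hdvd N.index_dvd_card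
    refine (Group.isSolvable_iff_subgroup_quotient N).2 ⟨ih _ ?_ h₁ rfl, ih _ ?_ h₂ rfl⟩
    · rw [← N.card_mul_index]
      exact lt_mul_of_one_lt_right Nat.card_pos (N.one_lt_index_of_ne_top hN1)
    · rw [← N.index_eq_card, ← N.index_mul_card]
      exact lt_mul_of_one_lt_right (Nat.pos_of_ne_zero N.index_ne_zero_of_finite)
        (N.one_lt_card_iff_ne_bot.2 hN0)
  · have hsimple : IsSimpleGroup G := ⟨fun N hN => by
      by_contra hcon
      rw [not_or] at hcon
      exact hs ⟨N, hN, hcon.1, hcon.2⟩⟩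
    have : Fact q.Prime := ⟨hq⟩
    have : Fact p.Prime := ⟨hp⟩
    obtain ⟨Q⟩ : Nonempty (Sylow q G) := inferInstance
    obtain ⟨k, hk⟩ : ∃ k, Q.index = p ^ k := by
      have hcop : Q.index.Coprime (q ^ b) :=
        (Nat.Coprime.pow_left b (hq.coprime_iff_not_dvd.2 Q.not_dvd_index)).symm
      have := hcop.dvd_of_dvd_mul_right (h ▸ Q.index_dvd_card)
      obtain ⟨k, -, hk⟩ := (Nat.dvd_prime_pow hp).1 this
      exact ⟨k, hk⟩
    suffices hz : Subgroup.center G ≠ ⊥ by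
      have htop := (Subgroup.Normal.eq_bot_or_eq_top (H := Subgroup.center G)
        inferInstance).resolve_left hz
      exact Group.isSolvable_of_comm fun x y =>
        (Subgroup.mem_center_iff.1 (htop ▸ Subgroup.mem_top y) x)
    rcases subsingleton_or_nontrivial Q with hQ | hQ
    · have hP : IsPGroup p G := IsPGroup.of_card (n := k) (by
        rw [← hk, Q.eq_bot_of_subsingleton, Subgroup.index_bot])
      have := hP.center_nontrivial
      exact Subgroup.nontrivial_iff_ne_bot _ |>.1 this
    · have := Q.isPGroup'.center_nontrivial
      obtain ⟨z, hz⟩ := exists_ne (1 : Subgroup.center Q)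
      -- The centralizer of a nontrivial central element of `Q` contains `Q`, so its index is a
      -- power of `p`.
      have hle : (Q : Subgroup G) ≤ Subgroup.centralizer {((z : Q) : G)} := fun x hx => by
        rw [Subgroup.mem_centralizer_singleton_iff]
        exact congrArg Subtype.val (Subgroup.mem_center_iff.1 z.2 ⟨x, hx⟩)
      obtain ⟨l, -, hl⟩ := (Nat.dvd_prime_pow hp).1 (hk ▸ Subgroup.index_dvd_of_le hle)
      have hmem := IsSimpleGroup.mem_center_of_index_centralizer_eq_pow hp hl
      intro hbot
      rw [hbot, Subgroup.mem_bot] at hmem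
      exact hz (Subtype.ext (Subtype.ext hmem))

/-! ### Complements in nilpotent groups. -/

/-- In a finite nilpotent group, the elements of order prime to `p` form a `p`-complement. -/
theorem Group.IsNilpotent.exists_subgroup_mem_iff_coprime_orderOf {G : Type*} [Group G] [Finite G]
    (hG : Group.IsNilpotent G) (p : ℕ) [hp : Fact p.Prime] :
    ∃ M : Subgroup G, (∀ x, x ∈ M ↔ (orderOf x).Coprime p) ∧ (∃ k, M.index = p ^ k) := by
  by_cases hpG : p ∈ (Nat.card G).primeFactors
  · let e := Sylow.directProductOfNormal (G := G) fun {q hq} P => inferInstance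
    -- `G` is the product of its Sylow subgroups; the complement is the kernel of the projection to
    -- the `p`-part.
    let f : G →* (∀ P : Sylow p G, P) :=
      (Pi.evalMonoidHom (fun q : (Nat.card G).primeFactors => ∀ P : Sylow q G, P)
        ⟨p, hpG⟩).comp e.symm.toMonoidHom
    have hP : IsPGroup p (∀ P : Sylow p G, P) := by
      choose n hn using fun P : Sylow p G => IsPGroup.iff_card.1 P.isPGroup'
      have := Fintype.ofFinite (Sylow p G)
      exact IsPGroup.of_card (n := ∑ P, n P) (by
        rw [Nat.card_pi, ← Finset.prod_pow_eq_pow_sum]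
        exact Finset.prod_congr rfl fun P _ => hn P)
    refine ⟨f.ker, fun x => ⟨fun hx => ?_, fun hx => ?_⟩, ?_⟩
    · rw [Nat.coprime_comm, hp.out.coprime_iff_not_dvd]
      intro hdvd
      have hy : orderOf (x ^ (orderOf x / p)) = p := by
        rw [orderOf_pow_orderOf_div (orderOf_pos x).ne' hdvd]
      have hyf : x ^ (orderOf x / p) ∈ f.ker := pow_mem hx _
      generalize x ^ (orderOf x / p) = y at hy hyf
      have : e.symm y = 1 := by
        funext q
        by_cases hq : q = ⟨p, hpG⟩
        · subst hq; exact hyf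
        · funext P
          have : Fact (q : ℕ).Prime := ⟨Nat.prime_of_mem_primeFactors q.2⟩
          obtain ⟨k, hk⟩ := P.isPGroup' (e.symm y q P)
          have h1 : (e.symm y q P) ^ p = 1 := by
            have := congrFun (congrFun (map_pow e.symm y p) q) P
            rw [← hy, pow_orderOf_eq_one, map_one] at this
            rw [← hy]; exact this.symm
          have hc : Nat.Coprime p (q ^ k) :=
            Nat.Coprime.pow_right k ((Nat.coprime_primes hp.out this.out).2
              fun h => hq (Subtype.ext h.symm))
          exact orderOf_eq_one_iff.1 (Nat.eq_one_of_dvd_coprimes hc (orderOf_dvd_of_pow_eq_one h1)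
            (orderOf_dvd_of_pow_eq_one hk))
      rw [e.symm.map_eq_one_iff.1 this, orderOf_one] at hy
      exact hp.out.one_lt.ne hy
    · obtain ⟨k, hk⟩ := hP (f x)
      exact orderOf_eq_one_iff.1 (Nat.eq_one_of_dvd_coprimes (hx.pow_right k) (orderOf_map_dvd f x)
        (orderOf_dvd_of_pow_eq_one hk))
    · rw [Subgroup.index_ker]
      exact IsPGroup.iff_card.1 (hP.to_subgroup f.range)
  · refine ⟨⊤, fun x => ⟨fun _ => ?_, fun _ => trivial⟩, 0, by simp⟩
    rw [Nat.coprime_comm, hp.out.coprime_iff_not_dvd]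
    exact fun h => hpG (Nat.mem_primeFactors.2
      ⟨hp.out, h.trans (orderOf_dvd_natCard x), Nat.card_pos.ne'⟩)

theorem Group.IsNilpotent.exists_subgroup_coprime_natCard {G : Type*} [Group G] [Finite G]
    (hG : Group.IsNilpotent G) (p : ℕ) [hp : Fact p.Prime] :
    ∃ M : Subgroup G, (∀ x, x ∈ M ↔ (orderOf x).Coprime p) ∧ (∃ k, M.index = p ^ k) ∧
      (Nat.card M).Coprime p := by
  obtain ⟨M, hM, hk⟩ := hG.exists_subgroup_mem_iff_coprime_orderOf p
  refine ⟨M, hM, hk, ?_⟩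
  rw [Nat.coprime_comm, hp.out.coprime_iff_not_dvd]
  intro h
  obtain ⟨x, hx⟩ := exists_prime_orderOf_dvd_card' p h
  have := (hM x).1 x.2
  rw [Subgroup.orderOf_coe, hx, Nat.coprime_self] at this
  exact hp.out.one_lt.ne' this

/-! ### Subgroups of coprime index. -/

namespace Subgroup

variable {G : Type*} [Group G]

/-- [G : H] divides [G : H ∩ K] = [K : H ∩ K] [G : K], hence divides the first factor, which is at
most [G : H]. -/
theorem relIndex_eq_index_of_coprime [Finite G] {H K : Subgroup G}
    (h : H.index.Coprime K.index) : H.relIndex K = H.index := by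
  have h1 : H.index ∣ H.relIndex K := by
    refine h.dvd_of_dvd_mul_right ?_
    rw [← inf_relIndex_right, relIndex_mul_index inf_le_right]
    exact index_dvd_of_le inf_le_left
  refine le_antisymm ?_ (Nat.le_of_dvd (Nat.pos_of_ne_zero ?_) h1)
  · simpa using relIndex_le_of_le_right (H := H) (le_top (a := K))
      (by simp [index_ne_zero_of_finite])
  · exact (isFiniteRelIndex_of_finiteIndex (H := H) (K := K)).relIndex_ne_zero

/-- K / (H ∩ K) embeds in G / H, and the two have the same size. -/
theorem exists_mul_eq_of_coprime_index [Finite G] {H K : Subgroup G}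
    (h : H.index.Coprime K.index) (x : G) : ∃ a ∈ K, ∃ b ∈ H, a * b = x := by
  let f : K ⧸ H.subgroupOf K → G ⧸ H := Quotient.map' Subtype.val fun a b hab => by
    rw [QuotientGroup.leftRel_apply] at hab ⊢
    simpa [mem_subgroupOf] using hab
  have hf : Function.Injective f := by
    rintro ⟨a⟩ ⟨b⟩ hab
    have := QuotientGroup.eq.1 hab
    exact QuotientGroup.eq.2 (by simpa [mem_subgroupOf] using this)
  obtain ⟨⟨a⟩, ha⟩ := ((Nat.bijective_iff_injective_and_card f).2
    ⟨hf, relIndex_eq_index_of_coprime h⟩).2 (QuotientGroup.mk x)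
  exact ⟨a, a.2, _, QuotientGroup.eq.1 ha, mul_inv_cancel_left _ _⟩

/-- [KN : K] = [N : N ∩ K] is a power of `p` dividing [G : K], so it is 1. -/
theorem le_of_isPGroup_of_not_dvd_index [Finite G] {p : ℕ} [hp : Fact p.Prime] {N K : Subgroup G}
    [N.Normal] (hN : IsPGroup p N) (hK : ¬ p ∣ K.index) : N ≤ K := by
  have h1 : Nat.card (N ⊓ K : Subgroup G) * K.relIndex (K ⊔ N) = Nat.card N := by
    have hpos : N.relIndex K ≠ 0 :=
      (isFiniteRelIndex_of_finiteIndex (H := N) (K := K)).relIndex_ne_zero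
    have h2 := relIndex_mul_relIndex ⊥ (N ⊓ K) K bot_le inf_le_right
    have h3 := relIndex_mul_relIndex ⊥ K (K ⊔ N) bot_le le_sup_left
    have h4 := relIndex_mul_relIndex ⊥ N (K ⊔ N) bot_le le_sup_right
    rw [relIndex_bot_left, relIndex_bot_left, inf_relIndex_right] at h2
    rw [relIndex_bot_left, relIndex_bot_left] at h3 h4
    rw [relIndex_sup_right, ← h3, ← h2] at h4
    refine (Nat.eq_of_mul_eq_mul_right (Nat.pos_of_ne_zero hpos) ?_).symm
    rw [h4]; ring
  obtain ⟨n, hn⟩ := IsPGroup.iff_card.1 hN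
  have h2 : (p ^ n).Coprime K.index := Nat.Coprime.pow_left n (hp.out.coprime_iff_not_dvd.2 hK)
  have h3 : K.relIndex (K ⊔ N) = 1 := Nat.eq_one_of_dvd_coprimes h2
    (hn ▸ h1 ▸ Dvd.intro_left _ rfl) (relIndex_dvd_index_of_le le_sup_left)
  exact le_sup_right.trans (relIndex_eq_one.1 h3)

end Subgroup

/-! ### The theorems of Wielandt and Hall. -/

namespace Group.IsSolvable

/-- The last nontrivial term of the derived series is abelian and normal; its elements killed by a
prime `p` dividing its order form the required subgroup. -/
theorem exists_normal_isPGroup {G : Type*} [Group G] [Finite G] [Nontrivial G]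
    (hG : Group.IsSolvable G) :
    ∃ p : ℕ, p.Prime ∧ ∃ N : Subgroup G, N.Normal ∧ N ≠ ⊥ ∧ IsPGroup p N := by
  classical
  obtain ⟨A, hA, hA0, hcomm⟩ : ∃ A : Subgroup G, A.Normal ∧ A ≠ ⊥ ∧ ⁅A, A⁆ = ⊥ := by
    have hex := hG.solvable
    have h0 : Nat.find hex ≠ 0 := fun h => by
      have := Nat.find_spec hex
      rw [h, derivedSeries_zero] at this
      exact top_ne_bot this
    obtain ⟨m, hm⟩ := Nat.exists_eq_succ_of_ne_zero h0
    refine ⟨derivedSeries G m, derivedSeries_normal G m, Nat.find_min hex (by omega), ?_⟩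
    rw [← derivedSeries_succ, ← Nat.succ_eq_add_one, ← hm]
    exact Nat.find_spec hex
  obtain ⟨p, hp, hpA⟩ := Nat.exists_prime_and_dvd (mt (Subgroup.card_eq_one).1 hA0)
  have hcomm' {x y : G} (hx : x ∈ A) (hy : y ∈ A) : Commute x y := by
    rw [Subgroup.commutator_eq_bot_iff_le_centralizer] at hcomm
    exact (Subgroup.mem_centralizer_iff.1 (hcomm hx) y hy).symm
  have : Fact p.Prime := ⟨hp⟩
  let N : Subgroup G :=
    { carrier := {x | x ∈ A ∧ x ^ p = 1}
      mul_mem' := fun {x y} hx hy => ⟨A.mul_mem hx.1 hy.1, by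
        rw [(hcomm' hx.1 hy.1).mul_pow, hx.2, hy.2, one_mul]⟩
      one_mem' := ⟨A.one_mem, one_pow p⟩
      inv_mem' := fun {x} hx => ⟨A.inv_mem hx.1, by rw [inv_pow, hx.2, inv_one]⟩ }
  refine ⟨p, hp, N, ⟨fun x hx g => ⟨hA.conj_mem x hx.1 g, by rw [conj_pow, hx.2]; simp⟩⟩, ?_, ?_⟩
  · obtain ⟨x, hx⟩ := exists_prime_orderOf_dvd_card' p hpA
    intro hN
    have hxN : (x : G) ∈ N := ⟨x.2, by rw [← hx, ← Subgroup.orderOf_coe, pow_orderOf_eq_one]⟩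
    rw [hN, Subgroup.mem_bot] at hxN
    rw [← Subgroup.orderOf_coe, hxN, orderOf_one] at hx
    exact hp.one_lt.ne hx
  · exact fun x => ⟨1, Subtype.ext (by simpa using x.2.2)⟩

end Group.IsSolvable

/-- As G = KH and `H` normalises `N`, every conjugate of `N` is a conjugate by an element of `K`. -/
theorem Subgroup.normalClosure_le_of_coprime_index {G : Type*} [Group G] [Finite G]
    {H K N : Subgroup G} (h : H.index.Coprime K.index) (hN : ∀ x ∈ H, ∀ n ∈ N, x * n * x⁻¹ ∈ N)
    (hNK : N ≤ K) : normalClosure (N : Set G) ≤ K := by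
  rw [normalClosure, closure_le]
  intro y hy
  obtain ⟨n, hn, hny⟩ := Group.mem_conjugatesOfSet_iff.1 hy
  obtain ⟨x, rfl⟩ := isConj_iff.1 hny
  obtain ⟨a, ha, b, hb, rfl⟩ := exists_mul_eq_of_coprime_index h x
  have := K.mul_mem (K.mul_mem ha (hNK (hN b hb n hn))) (K.inv_mem ha)
  simpa [mul_assoc] using this

/-- Wielandt: a finite group with three soluble subgroups of pairwise coprime indices is soluble. -/
theorem Group.isSolvable_of_coprime_index {G : Type*} [Group G] [Finite G] {H₁ H₂ H₃ : Subgroup G}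
    [h₁ : Group.IsSolvable H₁] [h₂ : Group.IsSolvable H₂] [h₃ : Group.IsSolvable H₃]
    (h₁₂ : H₁.index.Coprime H₂.index) (h₁₃ : H₁.index.Coprime H₃.index)
    (h₂₃ : H₂.index.Coprime H₃.index) : Group.IsSolvable G := by
  induction hn : Nat.card G using Nat.strong_induction_on generalizing G with
  | _ n ih =>
  subst hn
  -- The normal closure of `N` lies in the soluble group `K`, and the quotient by it inherits the
  -- three subgroups, with indices dividing the old ones.
  have main (K : Subgroup G) (hK : Group.IsSolvable K) (h : H₁.index.Coprime K.index)
      (N : Subgroup G) (hN0 : N ≠ ⊥) (hN : ∀ x ∈ H₁, ∀ n ∈ N, x * n * x⁻¹ ∈ N) (hNK : N ≤ K) :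
      Group.IsSolvable G := by
    let M := Subgroup.normalClosure (N : Set G)
    have hM : M ≤ K := Subgroup.normalClosure_le_of_coprime_index h hN hNK
    have hMs : Group.IsSolvable M :=
      Group.isSolvable_of_isSolvable_injective (Subgroup.inclusion_injective hM)
    refine (Group.isSolvable_iff_subgroup_quotient M).2 ⟨hMs, ?_⟩
    have hcard : Nat.card (G ⧸ M) < Nat.card G := by
      rw [← Subgroup.index_eq_card, ← Subgroup.index_mul_card M]
      refine lt_mul_of_one_lt_right (Nat.pos_of_ne_zero Subgroup.index_ne_zero_of_finite) ?_
      refine (Subgroup.one_lt_card_iff_ne_bot M).2 fun hM0 => hN0 ?_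
      exact le_bot_iff.1 (hM0 ▸ Subgroup.le_normalClosure)
    have hs (H : Subgroup G) (hH : Group.IsSolvable H) :
        Group.IsSolvable (H.map (QuotientGroup.mk' M)) :=
      Group.isSolvable_of_surjective ((QuotientGroup.mk' M).subgroupMap_surjective H)
    have hd (H : Subgroup G) := H.index_map_dvd (QuotientGroup.mk'_surjective M)
    exact ih _ hcard (h₁ := hs H₁ h₁) (h₂ := hs H₂ h₂) (h₃ := hs H₃ h₃)
      (Nat.Coprime.of_dvd (hd _) (hd _) h₁₂) (Nat.Coprime.of_dvd (hd _) (hd _) h₁₃)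
      (Nat.Coprime.of_dvd (hd _) (hd _) h₂₃) rfl
  rcases subsingleton_or_nontrivial H₁ with hH | hH
  · rw [H₁.eq_bot_of_subsingleton, Subgroup.index_bot] at h₁₂
    have : H₂ = ⊤ := Subgroup.index_eq_one.1
      (Nat.eq_one_of_dvd_coprimes h₁₂ H₂.index_dvd_card dvd_rfl)
    have hsurj : Function.Surjective H₂.subtype := fun x => ⟨⟨x, this ▸ Subgroup.mem_top x⟩, rfl⟩
    exact @Group.isSolvable_of_surjective _ _ _ _ _ hsurj h₂
  · obtain ⟨p, hp, N, hN, hN0, hNp⟩ := h₁.exists_normal_isPGroup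
    have : Fact p.Prime := ⟨hp⟩
    have hle (K : Subgroup G) (h : H₁.index.Coprime K.index) (hpK : ¬ p ∣ K.index) :
        N.map H₁.subtype ≤ K := by
      rw [← Subgroup.relIndex_eq_index_of_coprime h.symm] at hpK
      rw [Subgroup.map_le_iff_le_comap]
      exact Subgroup.le_of_isPGroup_of_not_dvd_index hNp hpK
    have hconj : ∀ x ∈ H₁, ∀ n ∈ N.map H₁.subtype, x * n * x⁻¹ ∈ N.map H₁.subtype := by
      rintro x hx _ ⟨n, hn, rfl⟩
      exact ⟨⟨x, hx⟩ * n * ⟨x, hx⟩⁻¹, hN.conj_mem n hn _, rfl⟩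
    have h0 : N.map H₁.subtype ≠ ⊥ := fun h =>
      hN0 ((Subgroup.map_eq_bot_iff_of_injective _ H₁.subtype_injective).1 h)
    -- `p` divides at most one of the two coprime indices, so `N` lies in the other subgroup.
    by_cases hp2 : p ∣ H₂.index
    · exact main H₃ h₃ h₁₃ _ h0 hconj (hle H₃ h₁₃ fun hp3 =>
        Nat.not_coprime_of_dvd_of_dvd hp.one_lt hp2 hp3 h₂₃)
    · exact main H₂ h₂ h₁₂ _ h0 hconj (hle H₂ h₁₂ hp2)

/-- P. Hall: a finite group having a `p`-complement for every prime `p` is soluble. -/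
theorem Group.isSolvable_of_forall_exists_complement {G : Type*} [Group G] [Finite G]
    (h : ∀ p : ℕ, p.Prime → ∃ H : Subgroup G, (∃ k, H.index = p ^ k) ∧ (Nat.card H).Coprime p) :
    Group.IsSolvable G := by
  induction hn : Nat.card G using Nat.strong_induction_on generalizing G with
  | _ n ih =>
  subst hn
  by_cases h3 : (Nat.card G).primeFactors.card ≤ 2
  · obtain ⟨p, q, hp, hq, hpq⟩ :
        ∃ p q : ℕ, p.Prime ∧ q.Prime ∧ ∃ a b, Nat.card G = p ^ a * q ^ b := by
      have hprod := Nat.prod_primeFactors_pow_factorization (Nat.card_pos (α := G)).ne'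
      have hpr : ∀ p ∈ (Nat.card G).primeFactors, p.Prime :=
        fun p => Nat.prime_of_mem_primeFactors
      generalize (Nat.card G).primeFactors = s at *
      interval_cases hs : s.card
      · rw [Finset.card_eq_zero.1 hs] at hprod
        exact ⟨2, 2, Nat.prime_two, Nat.prime_two, 0, 0, by simpa using hprod⟩
      · obtain ⟨p, rfl⟩ := Finset.card_eq_one.1 hs
        exact ⟨p, p, hpr p (by simp), hpr p (by simp), _, 0, by simpa using hprod⟩
      · obtain ⟨p, q, hne, rfl⟩ := Finset.card_eq_two.1 hs
        exact ⟨p, q, hpr p (by simp), hpr q (by simp), _, _,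
          by simpa [Finset.prod_pair hne] using hprod⟩
    obtain ⟨a, b, hab⟩ := hpq
    exact Group.isSolvable_of_natCard_eq_mul hp hq hab
  · obtain ⟨p, q, r, hp, hq, hr, hpq, hpr, hqr⟩ := Finset.two_lt_card_iff.1 (not_le.1 h3)
    -- A `p`-complement inherits the hypothesis: by coprimality of indices, its intersection with an
    -- `r`-complement is an `r`-complement in it. For r = p it is its own complement.
    have key (p : ℕ) (hp : p ∈ (Nat.card G).primeFactors) :
        ∃ H : Subgroup G, (∃ k, H.index = p ^ k) ∧ Group.IsSolvable H := by
      have hpp := Nat.prime_of_mem_primeFactors hp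
      obtain ⟨H, ⟨k, hk⟩, hH⟩ := h p hpp
      refine ⟨H, ⟨k, hk⟩, ih (Nat.card H) ?_ (fun r hr => ?_) rfl⟩
      · refine lt_of_le_of_ne (Nat.le_of_dvd Nat.card_pos H.card_subgroup_dvd_card) fun heq => ?_
        rw [heq] at hH
        exact hpp.one_lt.ne'
          (Nat.eq_one_of_dvd_coprimes hH (Nat.dvd_of_mem_primeFactors hp) dvd_rfl)
      · rcases eq_or_ne r p with rfl | hne
        · exact ⟨⊤, ⟨0, by simp⟩, by simpa using hH⟩
        · obtain ⟨R, ⟨l, hl⟩, hR⟩ := h r hr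
          refine ⟨R.subgroupOf H, ⟨l, ?_⟩, ?_⟩
          · rw [← hl]
            refine Subgroup.relIndex_eq_index_of_coprime ?_
            rw [hl, hk]
            exact Nat.Coprime.pow _ _ ((Nat.coprime_primes hr hpp).2 hne)
          · refine Nat.Coprime.coprime_dvd_left ?_ hR
            rw [← Subgroup.inf_subgroupOf_right,
              Nat.card_congr (Subgroup.subgroupOfEquivOfLe inf_le_right).toEquiv]
            exact Subgroup.card_dvd_of_le inf_le_left
    obtain ⟨H₁, ⟨k₁, e₁⟩, h₁⟩ := key p hp
    obtain ⟨H₂, ⟨k₂, e₂⟩, h₂⟩ := key q hq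
    obtain ⟨H₃, ⟨k₃, e₃⟩, h₃⟩ := key r hr
    have hp' := Nat.prime_of_mem_primeFactors hp
    have hq' := Nat.prime_of_mem_primeFactors hq
    have hr' := Nat.prime_of_mem_primeFactors hr
    refine Group.isSolvable_of_coprime_index (H₁ := H₁) (H₂ := H₂) (H₃ := H₃) ?_ ?_ ?_ <;>
      simp only [e₁, e₂, e₃]
    · exact Nat.Coprime.pow _ _ ((Nat.coprime_primes hp' hq').2 hpq)
    · exact Nat.Coprime.pow _ _ ((Nat.coprime_primes hp' hr').2 hpr)
    · exact Nat.Coprime.pow _ _ ((Nat.coprime_primes hq' hr').2 hqr)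

/-! ### From group-like elements to Galois automorphisms. -/

namespace HopfGaloisStructure

variable {K L H : Type*} [Field K] [Field L] [Algebra K L] [Ring H] [HopfAlgebra K H]
  (S : HopfGaloisStructure K L H)

/-- The evaluation `L ⊗ H → L`, `a ⊗ h ↦ a * (h · y)`. -/
noncomputable def evalAt (y : L) : L ⊗[K] H →ₗ[L] L :=
  LinearMap.liftBaseChangeEquiv L (S.act.toLinearMap.flip y)

@[simp]
theorem evalAt_tmul (y a : L) (h : H) : S.evalAt y (a ⊗ₜ h) = a * S.act h y := by
  simp [evalAt]

theorem evalAt_add (x y : L) (z : L ⊗[K] H) :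
    S.evalAt (x + y) z = S.evalAt x z + S.evalAt y z := by
  induction z with
  | zero => simp
  | tmul a h => simp [mul_add]
  | add z w hz hw => simp only [map_add, hz, hw]; abel

theorem evalAt_mul (x y : L) (z : L ⊗[K] H) :
    S.evalAt (x * y) z =
      LinearMap.mul' L L (TensorProduct.map (S.evalAt x) (S.evalAt y)
        (Coalgebra.comul (R := L) z)) := by
  induction z with
  | zero => simp
  | add z w hz hw => simp only [map_add, hz, hw]
  | tmul a h =>
    rw [evalAt_tmul, act_mul, TensorProduct.comul_tmul]
    induction (Coalgebra.comul (R := K) h) with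
    | zero => simp
    | add u v hu hv => simp only [map_add, mul_add, hu, hv, TensorProduct.tmul_add]
    | tmul u v => simp; ring

theorem evalAt_algebraMap (k : K) (z : L ⊗[K] H) :
    S.evalAt (algebraMap K L k) z = Coalgebra.counit (R := L) z * algebraMap K L k := by
  induction z with
  | zero => simp
  | add z w hz hw => simp only [map_add, hz, hw, add_mul]
  | tmul a h =>
    rw [evalAt_tmul, act_algebraMap, TensorProduct.counit_tmul]
    simp [Algebra.smul_def]; ring

/-- A group-like element of `L ⊗ H` acts on `L` by a homomorphism of `K`-algebras. -/
noncomputable def groupLikeHom (z : L ⊗[K] H) (hz : IsGroupLikeElem L z) : L →ₐ[K] L :=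
  AlgHom.ofLinearMap
    { toFun := fun y => S.evalAt y z
      map_add' := fun x y => S.evalAt_add x y z
      map_smul' := fun c x => by
        simp [Algebra.smul_def, evalAt_mul, hz.comul_eq_tmul_self, evalAt_algebraMap,
          hz.counit_eq_one] }
    (by simpa [hz.counit_eq_one] using S.evalAt_algebraMap 1 z)
    (fun x y => by simp [evalAt_mul, hz.comul_eq_tmul_self])

@[simp]
theorem groupLikeHom_apply (z : L ⊗[K] H) (hz : IsGroupLikeElem L z) (y : L) :
    S.groupLikeHom z hz y = S.evalAt y z := rfl

/-- Surjectivity of θ: every `K`-linear map H → L is a sum of maps h ↦ x (h · y), so all such maps,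
in particular the coordinates, kill `z`. -/
theorem eq_zero_of_evalAt_eq_zero {z : L ⊗[K] H} (hz : ∀ y, S.evalAt y z = 0) : z = 0 := by
  have key (f : H →ₗ[K] L) : LinearMap.liftBaseChangeEquiv L f z = 0 := by
    obtain ⟨t, rfl⟩ := S.bijective.2 f
    induction t with
    | zero => simp
    | add t u ht hu => rw [map_add, map_add, LinearMap.add_apply, ht, hu, add_zero]
    | tmul x y =>
      rw [← mul_zero x, ← hz y]
      clear hz
      induction z with
      | zero => simp
      | add z w hz hw => simp only [map_add, hz, hw, mul_add]
      | tmul a h => simp [hopfGaloisMap]; ring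
  let b := (Module.Free.chooseBasis K H)
  refine (b.baseChange L).ext_elem fun i => ?_
  rw [map_zero, Finsupp.zero_apply, ← key ((Algebra.linearMap K L).comp (b.coord i))]
  clear hz key
  induction z with
  | zero => simp
  | add z w hz hw => simp only [map_add, hz, hw, Finsupp.add_apply]
  | tmul a h => simp [Algebra.smul_def, mul_comm]

theorem eq_of_evalAt_eq {z w : L ⊗[K] H} (h : ∀ y, S.evalAt y z = S.evalAt y w) : z = w :=
  sub_eq_zero.1 <| S.eq_zero_of_evalAt_eq_zero fun y => by rw [map_sub, h, sub_self]

theorem evalAt_act (y : L) (h : H) (z : L ⊗[K] H) :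
    S.evalAt (S.act h y) z = S.evalAt y (z * 1 ⊗ₜ h) := by
  induction z with
  | zero => simp
  | add z w hz hw => simp only [map_add, hz, hw, add_mul]
  | tmul a h => simp

/-- The composition of the maps attached to group-like elements is a twisted multiplication. -/
theorem evalAt_evalAt {z : L ⊗[K] H} (hz : IsGroupLikeElem L z) (w : L ⊗[K] H) (y : L) :
    S.evalAt (S.evalAt y w) z =
      S.evalAt y (z * Algebra.TensorProduct.map (S.groupLikeHom z hz) (AlgHom.id K H) w) := by
  induction w with
  | zero => simpa using (S.groupLikeHom z hz).map_zero
  | add u v hu hv => simp only [map_add, mul_add, ← hu, ← hv, evalAt_add]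
  | tmul a h =>
    have : (S.groupLikeHom z hz a) ⊗ₜ[K] h
      = algebraMap L (L ⊗[K] H) (S.groupLikeHom z hz a) * 1 ⊗ₜ h := by simp
    rw [Algebra.TensorProduct.map_tmul, AlgHom.id_apply, evalAt_tmul, this, ← mul_assoc,
      ← Algebra.commutes, mul_assoc, ← Algebra.smul_def, map_smul, ← evalAt_act, smul_eq_mul,
      ← groupLikeHom_apply (hz := hz), map_mul]
    rfl

variable {G : Type*} [Group G] (e : (L ⊗[K] H) ≃ₐc[L] MonoidAlgebra L G)

/-- The group-like element of `L ⊗ H` corresponding to `g : G` under `L ⊗ H ≃ L[G]`. -/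
noncomputable def groupLikeOf : G →* L ⊗[K] H :=
  ((e : (L ⊗[K] H) ≃ₐ[L] MonoidAlgebra L G).symm : MonoidAlgebra L G →* L ⊗[K] H).comp
    (MonoidAlgebra.of L G)

theorem groupLikeOf_injective : Function.Injective (groupLikeOf e) :=
  (e : (L ⊗[K] H) ≃ₐ[L] MonoidAlgebra L G).symm.injective.comp MonoidAlgebra.of_injective

theorem isGroupLikeElem_groupLikeOf (g : G) : IsGroupLikeElem L (groupLikeOf e g) :=
  (MonoidAlgebra.isGroupLikeElem_of (R := L) (A := L) g).map e.symm

variable [FiniteDimensional K L]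

/-- The automorphism of `L` given by the action of the group-like element attached to `g`. -/
noncomputable def galOf (g : G) : Gal(L/K) :=
  (algEquivEquivAlgHom K L).symm
    (S.groupLikeHom (groupLikeOf e g) (isGroupLikeElem_groupLikeOf e g))

theorem toAlgHom_galOf (g : G) : (S.galOf e g : L →ₐ[K] L) =
    S.groupLikeHom (groupLikeOf e g) (isGroupLikeElem_groupLikeOf e g) :=
  (algEquivEquivAlgHom K L).apply_symm_apply _

theorem galOf_apply (g : G) (y : L) : S.galOf e g y = S.evalAt y (groupLikeOf e g) :=
  DFunLike.congr_fun (S.toAlgHom_galOf e g) y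

theorem galOf_injective : Function.Injective (S.galOf e) := fun g h hgh =>
  groupLikeOf_injective e <| S.eq_of_evalAt_eq fun y => by rw [← galOf_apply, ← galOf_apply, hgh]

/-- Bijectivity of θ compares dimensions: [L : K]² = dim H · [L : K], and dim H = |G| by base
change. -/
theorem natCard_eq_finrank (S : HopfGaloisStructure K L H)
    (e : (L ⊗[K] H) ≃ₐc[L] MonoidAlgebra L G) :
    Nat.card G = Module.finrank K L := by
  have : Finite G := Finite.of_injective _ (S.galOf_injective e)
  have := Fintype.ofFinite G
  have h1 : Module.finrank K H = Nat.card G := by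
    rw [← Module.finrank_baseChange (R := L),
      LinearEquiv.finrank_eq (e : (L ⊗[K] H) ≃ₐ[L] MonoidAlgebra L G).toLinearEquiv,
      LinearEquiv.finrank_eq (MonoidAlgebra.coeffLinearEquiv L), Module.finrank_finsupp_self,
      Nat.card_eq_fintype_card]
  have : Module.Finite K H := Module.finite_of_finrank_pos (h1 ▸ Nat.card_pos)
  have h2 := LinearEquiv.finrank_eq (LinearEquiv.ofBijective _ S.bijective)
  rw [Module.finrank_linearMap, Module.finrank_tensorProduct, h1] at h2
  exact (Nat.eq_of_mul_eq_mul_right Module.finrank_pos h2).symm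

variable [IsGalois K L]

theorem galOf_bijective : Function.Bijective (S.galOf e) := by
  rw [Nat.bijective_iff_injective_and_card, S.natCard_eq_finrank e, IsGalois.card_aut_eq_finrank]
  exact ⟨S.galOf_injective e, rfl⟩

/-- The bijection `G → Gal(L/K)` is multiplicative up to a twist by an automorphism of `L ⊗ H`,
which preserves the orders of elements. -/
theorem exists_galOf_mul (g h : G) :
    ∃ h' : G, orderOf h' = orderOf h ∧ S.galOf e g * S.galOf e h = S.galOf e (g * h') := by
  obtain ⟨k, hk⟩ := (S.galOf_bijective e).2 (S.galOf e g * S.galOf e h)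
  refine ⟨g⁻¹ * k, ?_, by rw [mul_inv_cancel_left, hk]⟩
  -- `f` is a ring automorphism, linear over `K` though not in general over `L`; preservation of
  -- orders needs only its multiplicativity and injectivity.
  let f := Algebra.TensorProduct.congr (S.galOf e g) (AlgEquiv.refl : H ≃ₐ[K] H)
  have key : groupLikeOf e k = groupLikeOf e g * f (groupLikeOf e h) := by
    refine S.eq_of_evalAt_eq fun y => ?_
    rw [← galOf_apply, hk, AlgEquiv.mul_apply, galOf_apply, galOf_apply,
      S.evalAt_evalAt (isGroupLikeElem_groupLikeOf e g), ← toAlgHom_galOf]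
    rfl
  have key' : groupLikeOf e (g⁻¹ * k) = f (groupLikeOf e h) := by
    rw [map_mul, key, ← mul_assoc, ← map_mul, inv_mul_cancel, map_one, one_mul]
  rw [← orderOf_injective _ (groupLikeOf_injective e), key',
    ← orderOf_injective _ (groupLikeOf_injective e) h]
  exact orderOf_injective (f : L ⊗[K] H →* L ⊗[K] H) f.injective _

/-- A subgroup of `G` determined by the orders of its elements gives rise to a subgroup of the
Galois group of the same order. -/
theorem exists_subgroup_natCard_eq (S : HopfGaloisStructure K L H)
    (e : (L ⊗[K] H) ≃ₐc[L] MonoidAlgebra L G) (M : Subgroup G)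
    (hM : ∀ x y, orderOf x = orderOf y → x ∈ M → y ∈ M) :
    ∃ N : Subgroup Gal(L/K), Nat.card N = Nat.card M := by
  have hmul {a b : Gal(L/K)} (ha : a ∈ S.galOf e '' M) (hb : b ∈ S.galOf e '' M) :
      a * b ∈ S.galOf e '' M := by
    obtain ⟨⟨g, hg, rfl⟩, ⟨h, hh, rfl⟩⟩ := ha, hb
    obtain ⟨h', ho, h'e⟩ := S.exists_galOf_mul e g h
    exact ⟨g * h', M.mul_mem hg (hM _ _ ho.symm hh), h'e.symm⟩
  have hne : (S.galOf e '' M).Nonempty := ⟨_, 1, M.one_mem, rfl⟩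
  have hpow {a : Gal(L/K)} (ha : a ∈ S.galOf e '' M) (n : ℕ) : a ^ (n + 1) ∈ S.galOf e '' M := by
    induction n with
    | zero => simpa using ha
    | succ n ih => rw [pow_succ]; exact hmul ih ha
  have hone : (1 : Gal(L/K)) ∈ S.galOf e '' M := by
    obtain ⟨a, ha⟩ := hne
    have := hpow ha (orderOf a - 1)
    rwa [Nat.sub_add_cancel (orderOf_pos a), pow_orderOf_eq_one] at this
  refine ⟨⟨⟨⟨S.galOf e '' M, hmul⟩, hone⟩, fun {a} ha => ?_⟩,
    Nat.card_image_of_injective (S.galOf_injective e) _⟩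
  -- The exponent is 2 · orderOf a - 1, written as a successor; doubling keeps it positive when `a`
  -- has order 1.
  have : a⁻¹ = a ^ (2 * orderOf a - 2 + 1) := by
    rw [inv_eq_iff_mul_eq_one, ← pow_succ',
      show 2 * orderOf a - 2 + 1 + 1 = orderOf a * 2 by have := orderOf_pos a; omega,
      pow_mul, pow_orderOf_eq_one, one_pow]
  rw [this]
  exact hpow ha _

end HopfGaloisStructure

theorem theorem1 {K L : Type*} [Field K] [Field L] [Algebra K L]
    [FiniteDimensional K L] [IsGalois K L]
    {H : Type*} [Ring H] [HopfAlgebra K H] (S : HopfGaloisStructure K L H)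
    {G : Type*} [Group G] (hS : S.HasType G) (hG : Group.IsNilpotent G) :
    Group.IsSolvable Gal(L/K) := by
  obtain ⟨e⟩ := hS
  have : Finite G := Finite.of_injective _ (S.galOf_injective e)
  refine Group.isSolvable_of_forall_exists_complement fun p hp => ?_
  have : Fact p.Prime := ⟨hp⟩
  obtain ⟨M, hM, ⟨k, hk⟩, hcop⟩ := hG.exists_subgroup_coprime_natCard p
  obtain ⟨N, hN⟩ := S.exists_subgroup_natCard_eq e M fun x y hxy hx =>
    (hM y).2 (hxy ▸ (hM x).1 hx)
  refine ⟨N, ⟨k, ?_⟩, hN ▸ hcop⟩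
  -- The index of `N` is that of `M`, since |N| = |M| and |Γ| = |G|.
  refine Nat.eq_of_mul_eq_mul_left (Nat.card_pos (α := N)) ?_
  rw [N.card_mul_index, hN, ← hk, M.card_mul_index]
  exact (Nat.card_congr (Equiv.ofBijective _ (S.galOf_bijective e))).symm
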